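/- Let $V$ be a locally small category. The category $\mathcal{G}V$ of graphs enriched in $V$ is defined as follows. An object $X$ consists of a (small) set $X_0$ and an object $X(a,b)$ of $V$ for each ordered pair $(a,b)$ of elements of $X_0$. A morphism $f:X\to Y$ consists of a function $f_0:X_0\to Y_0$ and morphisms $f_{a,b}:X(a,b)\to Y(f_0a,f_0b)$ of $V$ for all $a,b\in X_0$. Write $\mathcal{G}^2V=\mathcal{G}(\mathcal{G}V)$. Let $\lambda$ be a regular cardinal. An object $C$ of a category is connected when the representable $\mathrm{Hom}(C,-)$ preserves small coproducts, and $\lambda$-presentable when $\mathrm{Hom}(C,-)$ preserves $\lambda$-filtered colimits. A category $\mathcal{A}$ is $\lambda$-c-filtered when every functor $J\to\mathcal{A}$ with $J$ connected (in particular non-empty) and with fewer than $\lambda$ arrows admits a cocone. A locally small category is locally $\lambda$-presentable (respectively locally $\lambda$-c-presentable) when it is cocomplete and has a small set $\mathcal{S}$ of $\lambda$-presentable (respectively connected and $\lambda$-presentable) objects such that every object is a $\lambda$-filtered (respectively $\lambda$-c-filtered) colimit of objects of $\mathcal{S}$. An initial object is strict when every morphism into it is an isomorphism. A presheaf topos is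 a category equivalent to the category of presheaves of sets on a small category; a Grothendieck topos is a category equivalent to the category of sheaves of sets on a small site; it is locally connected when the left adjoint $I\mapsto\coprod_{i\in I}1$ of its global sections functor $\mathrm{Hom}(1,-)$ to $\mathbf{Set}$ itself has a left adjoint. Theorem. 1. If $V$ is locally $\lambda$-presentable then so is $\mathcal{G}V$. 2. If $V$ is locally $\lambda$-presentable and has a strict initial object, then $\mathcal{G}V$ is locally $\lambda$-c-presentable. 3. If $V$ is locally $\lambda$-presentable then $\mathcal{G}^2V$ is locally $\lambda$-c-presentable. 4. If $V$ is locally $\lambda$-c-presentable then so is $\mathcal{G}V$. 5. If $V$ is a presheaf topos then so is $\mathcal{G}V$. 6. If $V$ is a Grothendieck topos then $\mathcal{G}V$ is a locally connected Grothendieck topos. -/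

import Mathlib

open CategoryTheory Limits Opposite

universe w u

/-- A graph enriched in `V`: a (small) set of objects, and an object `hom a b` of `V` for each
ordered pair `(a, b)` of objects. -/
structure EnrichedGraph (V : Type u) : Type (max u (w + 1)) where
  obj : Type w
  hom : obj → obj → V

namespace EnrichedGraph

variable {V : Type u} [Category.{w} V]

/-- A morphism of `V`-graphs: an object function and hom maps `X(a, b) ⟶ Y(f a, f b)`. -/
@[ext]
structure Hom (X Y : EnrichedGraph.{w} V) : Type w where
  obj : X.obj → Y.obj
  map (a b : X.obj) : X.hom a b ⟶ Y.hom (obj a) (obj b)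

/-- The category `𝒢V` of `V`-graphs, for a locally small category `V`. -/
instance : Category.{w} (EnrichedGraph.{w} V) where
  Hom X Y := Hom X Y
  id X := { obj := fun a => a, map := fun a b => 𝟙 (X.hom a b) }
  comp f g :=
    { obj := fun a => g.obj (f.obj a)
      map := fun a b => f.map a b ≫ g.map (f.obj a) (f.obj b) }
  id_comp f := by
    cases f
    simp
  comp_id f := by
    cases f
    simp
  assoc f g h := by
    simp

end EnrichedGraph

section CPresentable

variable (C : Type u) [Category.{w} C]

/-- The connected objects `X` of `C`: those for which the representable `C(X, -)` preserves
(small) coproducts. -/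
def isConnectedObject : ObjectProperty C := fun X =>
  ∀ I : Type w, PreservesColimitsOfShape (Discrete I) (coyoneda.obj (op X))

/-- A category `J` is `κ`-c-filtered when every functor `A ⥤ J` from a `κ`-small connected
category `A` admits a cocone. (Connected categories are nonempty.) -/
class IsCardinalCFiltered (J : Type w) [SmallCategory J]
    (κ : Cardinal.{w}) [Fact κ.IsRegular] : Prop where
  nonempty_cocone {A : Type w} [SmallCategory A] [IsConnected A] (F : A ⥤ J)
    (hA : HasCardinalLT (Arrow A) κ) : Nonempty (Cocone F)

/-- A (locally small) category `C` is locally `κ`-c-presentable when it is cocomplete and there is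
a small set of connected `κ`-presentable objects such that every object of `C` is a
`κ`-c-filtered colimit of objects in this set. -/
class IsCardinalLocallyCPresentable (κ : Cardinal.{w}) [Fact κ.IsRegular] : Prop
    extends HasColimitsOfSize.{w, w} C where
  exists_generator : ∃ (S : ObjectProperty C) (_ : ObjectProperty.Small.{w} S),
    S ≤ isConnectedObject C ∧ S ≤ isCardinalPresentable C κ ∧
      ∀ X : C, ∃ (J : Type w) (_ : SmallCategory J) (_ : IsCardinalCFiltered J κ),
        S.colimitsOfShape J X

end CPresentable

section Toposes

variable (C : Type u) [Category.{w} C]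

/-- `C` is equivalent to the category of presheaves of sets on a small category. -/
def IsPresheafTopos : Prop :=
  ∃ (D : Type w) (_ : SmallCategory D), Nonempty (C ≌ (Dᵒᵖ ⥤ Type w))

/-- `C` is equivalent to the category of sheaves of sets on a small site. -/
def IsGrothendieckTopos : Prop :=
  ∃ (D : Type w) (_ : SmallCategory D) (J : GrothendieckTopology D),
    Nonempty (C ≌ Sheaf J (Type w))

/-- `C` is a Grothendieck topos which is locally connected: the left adjoint `Δ` of the global
sections functor `C(1, -) : C ⥤ Set`, that is the functor `I ↦ ∐ i : I, 1`, has itself a left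
adjoint. -/
def IsLocallyConnectedGrothendieckTopos : Prop :=
  IsGrothendieckTopos C ∧
    ∃ (T : C) (_ : IsTerminal T) (Δ : Type w ⥤ C) (_ : Δ ⊣ coyoneda.obj (op T)),
      Δ.IsRightAdjoint

end Toposes

/-!
Vertices of an enriched graph are morphisms from the one-vertex graph `point V`, and its edges of
shape `C` are morphisms from the two-vertex graph `edgeGraph.obj C`. Colimits are computed on
vertices and then on hom objects, where the hom object over a pair `(x, y)` of vertices is a
colimit indexed by the pairs of vertices lying over `(x, y)`. This indexing category is
`κ`-filtered for a `κ`-filtered diagram, and empty or with a terminal object for a coproduct. Hence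
`edgeGraph.obj C` is `κ`-presentable if `C` is, and connected if `C` admits no morphism to the
initial object.

A dense functor `D ⥤ V` induces a dense functor `WithVertex D ⥤ EnrichedGraph V`, with values the
point and the edge graphs. If the initial object of `V` is strict, the presentable objects without
morphisms to the initial object are still dense, so that connected presentable graphs are dense in
`EnrichedGraph V`; as these are closed under `κ`-small connected colimits, the canonical diagrams
are `κ`-c-filtered. Strictness holds in any category of graphs and in any locally `κ`-c-presentable
category.

Graphs enriched in presheaves on `D` are presheaves on `WithVertex D`, and likewise for sheaves when
the covering sieves of an object of `D` are required to contain both of its endpoints. In the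
resulting topos the constant object functor sends a set to the discrete graph on it, and its left
adjoint sends a graph to its set of connected components.
-/

section Generalities

lemma preservesColimit_of_isTerminal {J C D : Type*} [Category* J] [Category* C] [Category* D]
    {j : J} (hj : IsTerminal j) (F : J ⥤ C) (G : C ⥤ D) : PreservesColimit F G :=
  preservesColimit_of_preserves_colimit_cocone (colimitOfDiagramTerminal hj F)
    ((colimitOfDiagramTerminal hj (F ⋙ G)).ofIsoColimit (Cocone.ext (Iso.refl _)))

lemma preservesColimit_coyoneda_of_isEmpty {C : Type*} [Category* C] [HasInitial C] {X : C}
    (hX : IsEmpty (X ⟶ ⊥_ C)) {J : Type*} [Category* J] [IsEmpty J] (F : J ⥤ C) :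
    PreservesColimit F (coyoneda.obj (op X)) := by
  let c : Cocone F := { pt := ⊥_ C, ι := { app := isEmptyElim, naturality := isEmptyElim } }
  have hc : IsColimit c :=
    { desc s := initial.to s.pt, fac _ := isEmptyElim, uniq _ _ _ := initial.hom_ext _ _ }
  exact preservesColimit_of_preserves_colimit_cocone hc
    { desc s := ↾fun f => (hX.false f).elim
      fac _ := isEmptyElim
      uniq s _ _ := by ext f; exact (hX.false f).elim }

lemma nonempty_hom_elements_of_ι_eq {I : Type w} {K : Discrete I ⥤ Type w} {c : Cocone K}
    (hc : IsColimit c) {p q : K.Elements} (h : c.ι.app p.1 p.2 = c.ι.app q.1 q.2) :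
    Nonempty (p ⟶ q) := by
  let s : Cocone K :=
    { pt := K.Elements
      ι := Discrete.natTrans fun j => ↾fun a => K.elementsMk j a }
  have hs (p : K.Elements) : hc.desc s (c.ι.app p.1 p.2) = p :=
    ConcreteCategory.congr_hom (hc.fac s p.1) p.2
  exact ⟨eqToHom ((hs p).symm.trans ((congr_arg _ h).trans (hs q)))⟩

lemma isCardinalFiltered_elements {J : Type*} [Category* J] (K : J ⥤ Type*)
    (κ : Cardinal.{w}) [Fact κ.IsRegular] [IsCardinalFiltered J κ] [Nonempty K.Elements]
    (hK : ∀ (j : J) (x y : K.obj j), ∃ (l : J) (f : j ⟶ l), K.map f x = K.map f y) :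
    IsCardinalFiltered K.Elements κ where
  nonempty_cocone {A _} G hA := by
    have := isFiltered_of_isCardinalFiltered J κ
    obtain ⟨e⟩ := ‹Nonempty K.Elements›
    let c := IsCardinalFiltered.cocone (G ⋙ CategoryOfElements.π K) hA
    let k := IsFiltered.max e.1 c.pt
    let u : e.1 ⟶ k := IsFiltered.leftToMax e.1 c.pt
    let v (i : A) : (G.obj i).1 ⟶ k := c.ι.app i ≫ IsFiltered.rightToMax e.1 c.pt
    choose l f hf using fun i => hK k (K.map (v i) (G.obj i).2) (K.map u e.2)
    obtain ⟨m, a, b, hab⟩ := IsCardinalFiltered.wideSpan f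
      (hasCardinalLT_of_hasCardinalLT_arrow hA)
    have hmap (i : A) : K.map (v i ≫ b) (G.obj i).2 = K.map (u ≫ b) e.2 := by
      simp only [← hab i, Functor.map_comp, comp_apply, hf]
    refine ⟨⟨K.elementsMk m (K.map (u ≫ b) e.2),
      { app i := ⟨v i ≫ b, hmap i⟩
        naturality i j g := CategoryOfElements.ext _ _ _ ?_ }⟩⟩
    have hv : (G.map g).1 ≫ v j = v i :=
      (Category.assoc _ _ _).symm.trans (congr_arg (· ≫ _) (c.w g))
    exact ((Category.assoc _ _ _).symm.trans (congr_arg (· ≫ b) hv)).trans (Category.comp_id _).symm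

end Generalities

namespace EnrichedGraph

variable {V : Type u} [Category.{w} V]

section Basic

variable {X Y Z : EnrichedGraph.{w} V}

@[simp]
lemma id_obj (X : EnrichedGraph.{w} V) (a : X.obj) : Hom.obj (𝟙 X) a = a := rfl

@[simp]
lemma id_map (X : EnrichedGraph.{w} V) (a b : X.obj) : Hom.map (𝟙 X) a b = 𝟙 (X.hom a b) := rfl

@[simp]
lemma comp_obj (f : X ⟶ Y) (g : Y ⟶ Z) (a : X.obj) : (f ≫ g).obj a = g.obj (f.obj a) := rfl

@[simp]
lemma comp_map (f : X ⟶ Y) (g : Y ⟶ Z) (a b : X.obj) :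
    (f ≫ g).map a b = f.map a b ≫ g.map (f.obj a) (f.obj b) := rfl

/-- The hom map of a morphism of graphs, with values in the hom object of vertices that are only
propositionally equal to the images: equalities between such maps can be stated without casts. -/
def Hom.mapOfEq (f : X ⟶ Y) {a b : X.obj} {a' b' : Y.obj} (ha : f.obj a = a')
    (hb : f.obj b = b') : X.hom a b ⟶ Y.hom a' b' :=
  f.map a b ≫ eqToHom (by rw [ha, hb])

@[simp]
lemma Hom.mapOfEq_rfl (f : X ⟶ Y) (a b : X.obj) :
    Hom.mapOfEq f (rfl : f.obj a = f.obj a) (rfl : f.obj b = f.obj b) = f.map a b := by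
  simp [mapOfEq]

lemma Hom.mapOfEq_id {a b : X.obj} (ha : Hom.obj (𝟙 X) a = a) (hb : Hom.obj (𝟙 X) b = b) :
    Hom.mapOfEq (𝟙 X) ha hb = 𝟙 _ := by
  simp [mapOfEq]

lemma Hom.mapOfEq_comp {f : X ⟶ Y} {g : Y ⟶ Z} {h : X ⟶ Z} (w : f ≫ g = h) {a b : X.obj}
    {a' b' : Y.obj} {a'' b'' : Z.obj} (ha : f.obj a = a') (hb : f.obj b = b')
    (ha' : g.obj a' = a'') (hb' : g.obj b' = b'') (ha'' : h.obj a = a'') (hb'' : h.obj b = b'') :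
    Hom.mapOfEq f ha hb ≫ Hom.mapOfEq g ha' hb' = Hom.mapOfEq h ha'' hb'' := by
  subst w ha hb ha' hb'
  simp [mapOfEq]

lemma Hom.ext_mapOfEq {f g : X ⟶ Y} (hobj : ∀ a, f.obj a = g.obj a)
    (hmap : ∀ a b, Hom.mapOfEq f (hobj a) (hobj b) = g.map a b) : f = g := by
  obtain ⟨f₀, f₁⟩ := f
  obtain ⟨g₀, g₁⟩ := g
  obtain rfl : f₀ = g₀ := funext hobj
  congr
  ext a b
  simpa [mapOfEq] using hmap a b

end Basic

section Edges

variable (V) in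
/-- The functor sending a `V`-graph to its set of vertices. -/
def vertices : EnrichedGraph.{w} V ⥤ Type w where
  obj X := X.obj
  map f := ↾f.obj

/-- The edges of a `V`-graph relative to a functor `G : V ⥤ Type w`, regarded as the functor of
elements: a pair of vertices and an element of their hom object. For `G = V(C, -)` these are the
edges of shape `C`; for an evaluation functor of a presheaf category, the sections. -/
structure Edge (G : V ⥤ Type w) (X : EnrichedGraph.{w} V) : Type w where
  src : X.obj
  tgt : X.obj
  val : G.obj (X.hom src tgt)

namespace Edge

variable {G H K : V ⥤ Type w} {X Y Z : EnrichedGraph.{w} V}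

/-- The image of an edge under a morphism of graphs and a map of elements. -/
def map (α : G ⟶ H) (f : X ⟶ Y) (e : Edge G X) : Edge H Y where
  src := f.obj e.src
  tgt := f.obj e.tgt
  val := α.app _ (G.map (f.map e.src e.tgt) e.val)

/-- The endpoints of an edge. -/
def endpoint (e : Edge G X) : Bool → X.obj
  | false => e.src
  | true => e.tgt

lemma map_mk_of_eq (α : G ⟶ H) (f : X ⟶ Y) {a b : X.obj} {a' b' : Y.obj} (ha : f.obj a = a')
    (hb : f.obj b = b') (v : G.obj (X.hom a b)) :
    (Edge.mk a b v).map α f = Edge.mk a' b' (α.app _ (G.map (f.mapOfEq ha hb) v)) := by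
  subst ha hb
  simp [map]

end Edge

/-- The functor sending `G : V ⥤ Type w` and a `V`-graph to the edges of the graph relative
to `G`. -/
def edges : (V ⥤ Type w) ⥤ EnrichedGraph.{w} V ⥤ Type w where
  obj G :=
    { obj X := Edge G X
      map f := ↾(Edge.map (𝟙 G) f)
      map_id X := by ext; simp [Edge.map]
      map_comp f g := by ext; simp [Edge.map] }
  map α := { app X := ↾(Edge.map α (𝟙 X)), naturality X Y f := by ext; simp [Edge.map] }
  map_id G := by ext; simp [Edge.map]
  map_comp α β := by ext; simp [Edge.map]

/-- The source (for `false`) and the target (for `true`) of edges. -/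
def endpoint (G : V ⥤ Type w) (b : Bool) : edges.obj G ⟶ vertices V where
  app X := ↾fun e : Edge G X => e.endpoint b
  naturality X Y f := by ext e; cases b <;> rfl

end Edges

section Colimits

variable {J : Type*} [Category* J] {F : J ⥤ EnrichedGraph.{w} V}

section Fiber

variable (k : Cocone (F ⋙ vertices V)) (x y : k.pt)

/-- The pairs of vertices of the graphs `F.obj j` lying over a pair `(x, y)` of elements of the
point of a cocone on the vertices. -/
def fiber : J ⥤ Type w where
  obj j := { p : (F.obj j).obj × (F.obj j).obj // k.ι.app j p.1 = x ∧ k.ι.app j p.2 = y }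
  map f := ↾fun p => ⟨((F.map f).obj p.1.1, (F.map f).obj p.1.2),
    (ConcreteCategory.congr_hom (k.w f) p.1.1).trans p.2.1,
    (ConcreteCategory.congr_hom (k.w f) p.1.2).trans p.2.2⟩

lemma fiber_map_fst {p q : (fiber k x y).Elements} (f : p ⟶ q) :
    (F.map f.1).obj p.2.1.1 = q.2.1.1 :=
  congr_arg (fun z => z.1.1) f.2

lemma fiber_map_snd {p q : (fiber k x y).Elements} (f : p ⟶ q) :
    (F.map f.1).obj p.2.1.2 = q.2.1.2 :=
  congr_arg (fun z => z.1.2) f.2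

/-- The hom objects of the graphs `F.obj j` over a pair of elements of the point of a cocone on the
vertices. If the cocone is a colimit, the colimit of this diagram is a hom object of the colimit
of `F`. -/
def fiberDiagram : (fiber k x y).Elements ⥤ V where
  obj p := (F.obj p.1).hom p.2.1.1 p.2.1.2
  map f := (F.map f.1).mapOfEq (fiber_map_fst k x y f) (fiber_map_snd k x y f)
  map_id p := by simp
  map_comp f g := (Hom.mapOfEq_comp (F.map_comp f.1 g.1).symm _ _ _ _ _ _).symm

end Fiber

section FiberCocone

variable {k : Cocone (F ⋙ vertices V)} (s : Cocone F) {d : k.pt → s.pt.obj}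
  (hd : ∀ j (a : (F.obj j).obj), d (k.ι.app j a) = (s.ι.app j).obj a)

include hd in
lemma obj_fst_of_mem_fiber {x y : k.pt} (p : (fiber k x y).Elements) :
    (s.ι.app p.1).obj p.2.1.1 = d x :=
  (hd _ _).symm.trans (congr_arg d p.2.2.1)

include hd in
lemma obj_snd_of_mem_fiber {x y : k.pt} (p : (fiber k x y).Elements) :
    (s.ι.app p.1).obj p.2.1.2 = d y :=
  (hd _ _).symm.trans (congr_arg d p.2.2.2)

/-- The cocone on the hom objects over `(x, y)` induced by a cocone of graphs. -/
def fiberCocone (x y : k.pt) : Cocone (fiberDiagram k x y) where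
  pt := s.pt.hom (d x) (d y)
  ι :=
    { app p := (s.ι.app p.1).mapOfEq (obj_fst_of_mem_fiber s hd p) (obj_snd_of_mem_fiber s hd p)
      naturality _ _ f :=
        (Hom.mapOfEq_comp (s.w f.1) (fiber_map_fst k x y f) (fiber_map_snd k x y f)
          _ _ _ _).trans (Category.comp_id _).symm }

/-- The cocone of the hom object `c.pt.hom x y` on the hom objects lying over it. -/
abbrev homCocone (c : Cocone F) (x y : c.pt.obj) :
    Cocone (fiberDiagram ((vertices V).mapCocone c) x y) :=
  fiberCocone (k := (vertices V).mapCocone c) c (d := id) (fun _ _ => rfl) x y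

end FiberCocone

section IsColimit

variable {c : Cocone F}

/-- A cocone of graphs is a colimit if it is so on vertices and if every hom object of its point
is the colimit of the hom objects lying over it. -/
def isColimitOfHomCocone (hc : IsColimit ((vertices V).mapCocone c))
    (hhom : ∀ x y, IsColimit (homCocone c x y)) : IsColimit c :=
  let d (s : Cocone F) : c.pt.obj → s.pt.obj := hc.desc ((vertices V).mapCocone s)
  have hd (s : Cocone F) (j : J) (a : (F.obj j).obj) :
      d s ((c.ι.app j).obj a) = (s.ι.app j).obj a :=
    ConcreteCategory.congr_hom (hc.fac ((vertices V).mapCocone s) j) a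
  let k (s : Cocone F) := fiberCocone (k := (vertices V).mapCocone c) s (hd s)
  { desc s := { obj := d s, map x y := (hhom x y).desc (k s x y) }
    fac s j := by
      refine (Hom.ext_mapOfEq (fun a => (hd s j a).symm) fun a b => ?_).symm
      have hfac := (hhom _ _).fac (k s _ _) ⟨j, (a, b), rfl, rfl⟩
      exact hfac.symm.trans (congr_arg (· ≫ _) (Hom.mapOfEq_rfl (c.ι.app j) a b))
    uniq s m hm := by
      have hobj (x : c.pt.obj) : m.obj x = d s x := ConcreteCategory.congr_hom
        (hc.uniq ((vertices V).mapCocone s) (↾m.obj)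
          fun j => congr_arg (vertices V).map (hm j)) x
      exact Hom.ext_mapOfEq hobj fun x y => (hhom x y).uniq (k s x y) _ fun p =>
        Hom.mapOfEq_comp (hm p.1) p.2.2.1 p.2.2.2 (hobj x) (hobj y)
          (obj_fst_of_mem_fiber s (hd s) p) (obj_snd_of_mem_fiber s (hd s) p) }

/-- The cocone on the elements of the hom objects over `(x, y)` induced by a cocone on the edges
of a diagram of graphs. -/
def fiberCoconeOfEdges {G : V ⥤ Type w} (s : Cocone (F ⋙ edges.obj G))
    (k : Cocone (F ⋙ vertices V)) (x y : k.pt) : Cocone (fiberDiagram k x y ⋙ G) where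
  pt := s.pt
  ι :=
    { app p := ↾fun v => s.ι.app p.1 (Edge.mk p.2.1.1 p.2.1.2 v)
      naturality p q f := by
        ext v
        exact (congr_arg (s.ι.app q.1) (Edge.map_mk_of_eq (𝟙 G) (F.map f.1)
          (fiber_map_fst k x y f) (fiber_map_snd k x y f) v).symm).trans
            (ConcreteCategory.congr_hom (s.w f.1) (Edge.mk p.2.1.1 p.2.1.2 v)) }

/-- Edges commute with a colimit of graphs as soon as `G` preserves the colimits of hom objects
that make up the hom objects of this colimit. -/
def isColimitMapCoconeEdges {G : V ⥤ Type w}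
    (hhom : ∀ x y, IsColimit (G.mapCocone (homCocone c x y))) :
    IsColimit ((edges.obj G).mapCocone c) where
  desc s := ↾fun e : Edge G c.pt =>
    (hhom e.src e.tgt).desc (fiberCoconeOfEdges s ((vertices V).mapCocone c) e.src e.tgt) e.val
  fac s j := by
    ext ⟨a, b, v⟩
    refine Eq.trans ?_ (ConcreteCategory.congr_hom ((hhom _ _).fac
      (fiberCoconeOfEdges s ((vertices V).mapCocone c) _ _) ⟨j, (a, b), rfl, rfl⟩) v)
    exact congr_arg (fun f => (hhom _ _).desc _ (G.map f v))
      (Hom.mapOfEq_rfl (c.ι.app j) a b).symm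
  uniq s m hm := by
    ext ⟨x, y, v⟩
    refine ConcreteCategory.congr_hom ((hhom x y).uniq
      (fiberCoconeOfEdges s ((vertices V).mapCocone c) x y) (↾fun v => m (Edge.mk x y v))
        fun p => ?_) v
    ext v
    exact (congr_arg m (Edge.map_mk_of_eq (𝟙 G) (c.ι.app p.1)
      p.2.2.1 p.2.2.2 v).symm).trans
        (ConcreteCategory.congr_hom (hm p.1) (Edge.mk p.2.1.1 p.2.1.2 v))

end IsColimit

section ColimitGraph

variable (k : Cocone (F ⋙ vertices V)) [∀ x y, HasColimit (fiberDiagram k x y)]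

/-- The colimit of a diagram of graphs, over a colimit of the sets of vertices. -/
noncomputable def colimitGraph : EnrichedGraph.{w} V where
  obj := k.pt
  hom x y := colimit (fiberDiagram k x y)

/-- The coprojections of `colimitGraph`. -/
noncomputable def colimitGraphι (j : J) : F.obj j ⟶ colimitGraph k where
  obj := k.ι.app j
  map a b := colimit.ι (fiberDiagram k (k.ι.app j a) (k.ι.app j b)) ⟨j, (a, b), rfl, rfl⟩

lemma mapOfEq_colimitGraphι {x y : k.pt} (p : (fiber k x y).Elements) :
    (colimitGraphι k p.1).mapOfEq p.2.2.1 p.2.2.2 = colimit.ι (fiberDiagram k x y) p := by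
  obtain ⟨j, ⟨a, b⟩, rfl, rfl⟩ := p
  exact Hom.mapOfEq_rfl _ a b

lemma map_comp_colimitGraphι {i j : J} (f : i ⟶ j) :
    F.map f ≫ colimitGraphι k j = colimitGraphι k i := by
  have hk (a : (F.obj i).obj) : k.ι.app j ((F.map f).obj a) = k.ι.app i a :=
    ConcreteCategory.congr_hom (k.w f) a
  refine Hom.ext_mapOfEq hk fun a b => ?_
  let p := (fiber k (k.ι.app i a) (k.ι.app i b)).elementsMk i ⟨(a, b), rfl, rfl⟩
  let q := (fiber k (k.ι.app i a) (k.ι.app i b)).elementsMk j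
    ⟨((F.map f).obj a, (F.map f).obj b), hk a, hk b⟩
  let φ : p ⟶ q := ⟨f, rfl⟩
  have hφ : Hom.mapOfEq (F.map f) rfl rfl ≫ (colimitGraphι k j).mapOfEq (hk a) (hk b) =
      (colimitGraphι k i).map a b :=
    (congr_arg (Hom.mapOfEq (F.map f) rfl rfl ≫ ·) (mapOfEq_colimitGraphι k q)).trans
      (colimit.w (fiberDiagram k _ _) φ)
  exact (Hom.mapOfEq_comp rfl rfl rfl (hk a) (hk b) _ _).symm.trans hφ

/-- The cocone with point `colimitGraph`. -/
noncomputable def colimitGraphCocone : Cocone F where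
  pt := colimitGraph k
  ι :=
    { app := colimitGraphι k
      naturality _ _ f := (map_comp_colimitGraphι k f).trans (Category.comp_id _).symm }

/-- The hom objects of `colimitGraph` are the colimits of the hom objects lying over them. -/
noncomputable def isColimitHomCocone (x y : k.pt) :
    IsColimit (homCocone (colimitGraphCocone k) x y) :=
  (colimit.isColimit (fiberDiagram k x y)).ofIsoColimit
    (Cocone.ext (Iso.refl _) fun p =>
      (Category.comp_id _).trans (mapOfEq_colimitGraphι k p).symm)

end ColimitGraph

lemma exists_isColimit_homCocone {J : Type w} [SmallCategory J] (F : J ⥤ EnrichedGraph.{w} V)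
    [HasColimitsOfSize.{w, w} V] :
    ∃ c : Cocone F, Nonempty (IsColimit ((vertices V).mapCocone c)) ∧
      ∀ x y, Nonempty (IsColimit (homCocone c x y)) :=
  ⟨colimitGraphCocone (colimit.cocone (F ⋙ vertices V)), ⟨colimit.isColimit _⟩,
    fun x y => ⟨isColimitHomCocone _ x y⟩⟩

section

variable [HasColimitsOfSize.{w, w} V]

instance : HasColimitsOfSize.{w, w} (EnrichedGraph.{w} V) where
  has_colimits_of_shape _ _ :=
    { has_colimit F :=
        let ⟨_, ⟨hvertices⟩, hhom⟩ := exists_isColimit_homCocone F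
        ⟨⟨⟨_, isColimitOfHomCocone hvertices fun x y => (hhom x y).some⟩⟩⟩ }

instance : PreservesColimitsOfSize.{w, w} (vertices V) where
  preservesColimitsOfShape :=
    { preservesColimit {F} :=
        let ⟨_, ⟨hvertices⟩, hhom⟩ := exists_isColimit_homCocone F
        preservesColimit_of_preserves_colimit_cocone
          (isColimitOfHomCocone hvertices fun x y => (hhom x y).some) hvertices }

lemma preservesColimit_edges {J : Type w} [SmallCategory J] {F : J ⥤ EnrichedGraph.{w} V}
    {G : V ⥤ Type w}
    (hG : ∀ (k : Cocone (F ⋙ vertices V)), IsColimit k → ∀ x y : k.pt,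
      PreservesColimit (fiberDiagram k x y) G) :
    PreservesColimit F (edges.obj G) :=
  let ⟨_, ⟨hvertices⟩, hhom⟩ := exists_isColimit_homCocone F
  preservesColimit_of_preserves_colimit_cocone
    (isColimitOfHomCocone hvertices fun x y => (hhom x y).some)
    (isColimitMapCoconeEdges fun x y =>
      have := hG _ hvertices x y
      isColimitOfPreserves G (hhom x y).some)

end

end Colimits

section Representing

variable [HasInitial V]

variable (V) in
/-- The graph with one vertex and an initial hom object; it represents vertices. -/
noncomputable def point : EnrichedGraph.{w} V where
  obj := PUnit
  hom _ _ := ⊥_ V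

/-- The morphisms from `point V` to `X` are the vertices of `X`. -/
noncomputable def pointHomEquiv (X : EnrichedGraph.{w} V) : (point V ⟶ X) ≃ X.obj where
  toFun f := f.obj ⟨⟩
  invFun a := { obj _ := a, map _ _ := initial.to _ }
  left_inv _ := Hom.ext_mapOfEq (fun _ => rfl) fun _ _ => initialIsInitial.hom_ext _ _
  right_inv _ := rfl

/-- The vertex functor is corepresented by `point V`. -/
noncomputable def coyonedaPointIso : coyoneda.obj (op (point V)) ≅ vertices V :=
  NatIso.ofComponents (fun X => (pointHomEquiv X).toIso)

/-- The hom objects of `edgeGraph`. -/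
noncomputable def edgeGraphHom (C : V) : ULift.{w} Bool → ULift.{w} Bool → V
  | ⟨false⟩, ⟨true⟩ => C
  | _, _ => ⊥_ V

/-- The graph with two vertices and a single non-initial hom object `C`, as a functor of `C`; it
represents the edges of shape `C`. -/
noncomputable def edgeGraph : V ⥤ EnrichedGraph.{w} V where
  obj C := { obj := ULift Bool, hom := edgeGraphHom C }
  map u :=
    { obj i := i
      map
      | ⟨false⟩, ⟨true⟩ => u
      | ⟨false⟩, ⟨false⟩ => 𝟙 _
      | ⟨true⟩, _ => 𝟙 _ }
  map_id C := Hom.ext rfl <| heq_of_eq <| by ext ⟨_ | _⟩ ⟨_ | _⟩ <;> rfl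
  map_comp u v := Hom.ext rfl <| heq_of_eq <| by
    ext ⟨_ | _⟩ ⟨_ | _⟩
    exacts [(Category.comp_id _).symm, rfl, (Category.comp_id _).symm, (Category.comp_id _).symm]

/-- The morphisms from `edgeGraph.obj C` to `X` are the edges of shape `C` of `X`. -/
noncomputable def edgeGraphHomEquiv (C : V) (X : EnrichedGraph.{w} V) :
    (edgeGraph.obj C ⟶ X) ≃ Edge (coyoneda.obj (op C)) X where
  toFun f := ⟨f.obj ⟨false⟩, f.obj ⟨true⟩, f.map ⟨false⟩ ⟨true⟩⟩
  invFun e :=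
    { obj i := e.endpoint i.down
      map
      | ⟨false⟩, ⟨true⟩ => e.val
      | ⟨false⟩, ⟨false⟩ => initial.to _
      | ⟨true⟩, _ => initial.to _ }
  left_inv f := by
    refine Hom.ext_mapOfEq (fun i => ?_) fun i j => ?_
    · obtain ⟨_ | _⟩ := i <;> rfl
    · obtain ⟨_ | _⟩ := i <;> obtain ⟨_ | _⟩ := j
      · exact initialIsInitial.hom_ext _ _
      · exact Category.comp_id _
      · exact initialIsInitial.hom_ext _ _
      · exact initialIsInitial.hom_ext _ _
  right_inv _ := rfl

/-- The functor of edges of shape `C` is corepresented by `edgeGraph.obj C`, naturally in `C`. -/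
noncomputable def coyonedaEdgeGraphIso :
    edgeGraph.op ⋙ coyoneda ≅ coyoneda ⋙ edges (V := V) :=
  NatIso.ofComponents
    (fun C => NatIso.ofComponents fun X => (edgeGraphHomEquiv C.unop X).toIso)
    fun f => by
      ext X g
      exact congr_arg (Edge.mk _ _) (congr_arg (f.unop ≫ ·) (Category.comp_id _).symm)

end Representing

section Presentable

variable {J : Type w} [SmallCategory J] {F : J ⥤ EnrichedGraph.{w} V} {k : Cocone (F ⋙ vertices V)}

lemma nonempty_fiber_elements [IsFiltered J] (hk : IsColimit k) (x y : k.pt) :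
    Nonempty (fiber k x y).Elements := by
  obtain ⟨i, a, rfl⟩ := Types.jointly_surjective_of_isColimit hk x
  obtain ⟨j, b, rfl⟩ := Types.jointly_surjective_of_isColimit hk y
  exact ⟨IsFiltered.max i j, ((F.map (IsFiltered.leftToMax i j)).obj a,
    (F.map (IsFiltered.rightToMax i j)).obj b),
    ConcreteCategory.congr_hom (k.w (IsFiltered.leftToMax i j)) a,
    ConcreteCategory.congr_hom (k.w (IsFiltered.rightToMax i j)) b⟩

lemma exists_fiber_map_eq [IsFiltered J] (hk : IsColimit k) {x y : k.pt} (j : J)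
    (p q : (fiber k x y).obj j) :
    ∃ (l : J) (f : j ⟶ l), (fiber k x y).map f p = (fiber k x y).map f q := by
  obtain ⟨⟨a, b⟩, rfl, rfl⟩ := p
  obtain ⟨⟨a', b'⟩, ha, hb⟩ := q
  obtain ⟨l, f, hf⟩ := (Types.FilteredColimit.isColimit_eq_iff' hk a a').1 ha.symm
  obtain ⟨m, g, hg⟩ := (Types.FilteredColimit.isColimit_eq_iff' hk ((F.map f).obj b)
    ((F.map f).obj b')).1 (((ConcreteCategory.congr_hom (k.w f) b).trans hb.symm).trans
      (ConcreteCategory.congr_hom (k.w f) b').symm)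
  refine ⟨m, f ≫ g, ?_⟩
  have hmap (c : (F.obj j).obj) : (F.map (f ≫ g)).obj c = (F.map g).obj ((F.map f).obj c) := by
    rw [F.map_comp, comp_obj]
  exact Subtype.ext (Prod.ext
    ((hmap a).trans ((congr_arg (F.map g).obj hf).trans (hmap a').symm))
    ((hmap b).trans (hg.trans (hmap b').symm)))

lemma isCardinalFiltered_fiber_elements (κ : Cardinal.{w}) [Fact κ.IsRegular]
    [IsCardinalFiltered J κ] (hk : IsColimit k) (x y : k.pt) :
    IsCardinalFiltered (fiber k x y).Elements κ :=
  have := isFiltered_of_isCardinalFiltered J κ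
  have := nonempty_fiber_elements hk x y
  isCardinalFiltered_elements _ κ (exists_fiber_map_eq hk)

/-- A nonempty category of pairs of vertices over a given pair in a coproduct has a single
object, up to isomorphism. -/
noncomputable def isTerminalOfDiscrete {I : Type w} {F : Discrete I ⥤ EnrichedGraph.{w} V}
    {k : Cocone (F ⋙ vertices V)} (hk : IsColimit k) {x y : k.pt} (p : (fiber k x y).Elements) :
    IsTerminal p :=
  have nonempty_hom (q : (fiber k x y).Elements) : Nonempty (q ⟶ p) := by
    let src (r : (fiber k x y).Elements) := (F ⋙ vertices V).elementsMk r.1 r.2.1.1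
    let tgt (r : (fiber k x y).Elements) := (F ⋙ vertices V).elementsMk r.1 r.2.1.2
    obtain ⟨f, hf⟩ : Nonempty (src q ⟶ src p) :=
      nonempty_hom_elements_of_ι_eq hk (q.2.2.1.trans p.2.2.1.symm)
    obtain ⟨g, hg⟩ : Nonempty (tgt q ⟶ tgt p) :=
      nonempty_hom_elements_of_ι_eq hk (q.2.2.2.trans p.2.2.2.symm)
    obtain rfl : f = g := Subsingleton.elim _ _
    exact ⟨f, Subtype.ext (Prod.ext hf hg)⟩
  IsTerminal.ofUniqueHom (fun q => (nonempty_hom q).some)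
    fun _ _ => CategoryOfElements.ext _ _ _ (Subsingleton.elim (α := _ ⟶ _) _ _)

variable [HasColimitsOfSize.{w, w} V]

instance isCardinalPresentable_point (κ : Cardinal.{w}) [Fact κ.IsRegular] :
    IsCardinalPresentable (point V) κ :=
  Functor.isCardinalAccessible_of_natIso coyonedaPointIso.symm κ

instance isCardinalPresentable_edgeGraph (κ : Cardinal.{w}) [Fact κ.IsRegular]
    (C : V) [IsCardinalPresentable C κ] : IsCardinalPresentable (edgeGraph.obj C) κ :=
  have : ((coyoneda ⋙ edges (V := V)).obj (op C)).IsCardinalAccessible κ :=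
    { preservesColimitOfShape _ _ _ :=
        { preservesColimit := preservesColimit_edges fun k hk x y =>
            have := isCardinalFiltered_fiber_elements κ hk x y
            have := preservesColimitsOfShape_of_isCardinalPresentable C κ (fiber k x y).Elements
            inferInstance } }
  Functor.isCardinalAccessible_of_natIso (coyonedaEdgeGraphIso.app (op C)).symm κ

lemma isConnectedObject_point : isConnectedObject (EnrichedGraph.{w} V) (point V) := fun _ =>
  preservesColimitsOfShape_of_natIso coyonedaPointIso.symm

lemma isConnectedObject_edgeGraph {C : V} (hC : IsEmpty (C ⟶ ⊥_ V)) :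
    isConnectedObject (EnrichedGraph.{w} V) (edgeGraph.obj C) := fun I =>
  have : PreservesColimitsOfShape (Discrete I) ((coyoneda ⋙ edges (V := V)).obj (op C)) :=
    { preservesColimit := preservesColimit_edges fun k hk x y => by
        rcases isEmpty_or_nonempty (fiber k x y).Elements with _ | ⟨⟨p⟩⟩
        · exact preservesColimit_coyoneda_of_isEmpty hC _
        · exact preservesColimit_of_isTerminal (isTerminalOfDiscrete hk p) _ _ }
  preservesColimitsOfShape_of_natIso (coyonedaEdgeGraphIso.app (op C)).symm

end Presentable

end EnrichedGraph

/-- The objects of the category obtained from `D` by adjoining an object `vertex` together with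
two morphisms from `vertex` to each object of `D`. Presheaves on it are the graphs enriched in
presheaves on `D`. -/
inductive WithVertex (D : Type*)
  | vertex : WithVertex D
  | edge (c : D) : WithVertex D

namespace WithVertex

instance {D : Type*} [Small.{w} D] : Small.{w} (WithVertex D) :=
  small_of_surjective (f := Sum.elim edge fun _ : Unit => vertex) fun
    | vertex => ⟨.inr ⟨⟩, rfl⟩
    | edge c => ⟨.inl c, rfl⟩

universe v

variable {D : Type*} [Category.{v} D]

/-- The morphisms of `WithVertex D`; the two morphisms from `vertex` to an object of `D` are
indexed by `Bool`, with `false` for the source and `true` for the target. -/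
protected def Hom : WithVertex D → WithVertex D → Type v
  | vertex, vertex => PUnit
  | vertex, edge _ => ULift Bool
  | edge _, vertex => PEmpty
  | edge c, edge d => c ⟶ d

/-- The identities of `WithVertex D`. -/
protected def id : ∀ X : WithVertex D, WithVertex.Hom X X
  | vertex => ⟨⟩
  | edge c => 𝟙 c

/-- The composition of `WithVertex D`. -/
protected def comp : ∀ {X Y Z : WithVertex D},
    WithVertex.Hom X Y → WithVertex.Hom Y Z → WithVertex.Hom X Z
  | vertex, vertex, _, _, g => g
  | vertex, edge _, edge _, b, _ => b
  | edge _, edge _, edge _, f, g => f ≫ g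

instance : Category.{v} (WithVertex D) where
  Hom := WithVertex.Hom
  id := WithVertex.id
  comp := WithVertex.comp
  id_comp {X Y} f := by
    obtain _ | c := X <;> obtain _ | d := Y
    exacts [rfl, rfl, f.elim, Category.id_comp (X := c) f]
  comp_id {X Y} f := by
    obtain _ | c := X <;> obtain _ | d := Y
    exacts [rfl, rfl, f.elim, Category.comp_id (X := c) f]
  assoc {X Y Z T} f g h := by
    obtain _ | c := X <;> obtain _ | d := Y <;> obtain _ | e := Z <;> obtain _ | t := T
    all_goals first | rfl | exact f.elim | exact g.elim | exact h.elim | skip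
    exact Category.assoc (W := c) f g h

/-- The inclusion of `D` in `WithVertex D`. -/
def incl : D ⥤ WithVertex D where
  obj := edge
  map f := f

/-- The morphism from `vertex` selecting the source (for `false`) or the target (for `true`) of
an edge. -/
def endpoint (b : Bool) (c : D) : vertex ⟶ edge c := ULift.up b

@[elab_as_elim]
lemma hom_induction {motive : ∀ {X Y : WithVertex D}, (X ⟶ Y) → Prop}
    (id : motive (𝟙 vertex)) (endpoint : ∀ b c, motive (endpoint b c))
    (incl : ∀ {c d} (f : c ⟶ d), motive (incl.map f)) {X Y : WithVertex D} (f : X ⟶ Y) :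
    motive f := by
  obtain _ | c := X <;> obtain _ | d := Y
  exacts [id, endpoint f.down d, f.elim, incl f]

section

variable {T : Type*} [Category* T]

/-- The functor from `WithVertex D` given by a functor from `D` and two natural transformations
to it from a constant functor. -/
def desc (v : T) (K : D ⥤ T) (p : Bool → ((Functor.const D).obj v ⟶ K)) : WithVertex D ⥤ T where
  obj
    | vertex => v
    | edge c => K.obj c
  map {X Y} f := match X, Y, f with
    | vertex, vertex, _ => 𝟙 v
    | vertex, edge c, b => (p b.down).app c
    | edge _, edge _, f => K.map f
  map_id X := by
    obtain _ | c := X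
    exacts [rfl, K.map_id c]
  map_comp {X Y Z} f g := by
    induction f using hom_induction with
    | id => exact (Category.id_comp _).symm
    | endpoint b c =>
      obtain _ | d := Z
      · exact g.elim
      · exact ((Category.id_comp _).symm.trans ((p b).naturality g))
    | incl f =>
      obtain _ | d := Z
      · exact g.elim
      · exact K.map_comp f g

/-- A natural transformation between presheaves on `WithVertex D`, given by its component at
`vertex` and its restriction to `D`. -/
def natTransMk {P Q : (WithVertex D)ᵒᵖ ⥤ T} (φ : P.obj (op vertex) ⟶ Q.obj (op vertex))
    (ψ : incl.op ⋙ P ⟶ incl.op ⋙ Q)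
    (h : ∀ b c, P.map (endpoint b c).op ≫ φ = ψ.app (op c) ≫ Q.map (endpoint b c).op) :
    P ⟶ Q where
  app
    | op vertex => φ
    | op (edge c) => ψ.app (op c)
  naturality X Y f := by
    obtain ⟨X⟩ := X
    obtain ⟨Y⟩ := Y
    obtain ⟨f, rfl⟩ : ∃ g : Y ⟶ X, g.op = f := ⟨f.unop, rfl⟩
    induction f using hom_induction with
    | id =>
      exact (congr_arg (· ≫ φ) (P.map_id _)).trans ((Category.id_comp φ).trans
        ((congr_arg (φ ≫ ·) (Q.map_id _)).trans (Category.comp_id φ)).symm)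
    | endpoint b c => exact h b c
    | incl f => exact ψ.naturality f.op

/-- An isomorphism of presheaves on `WithVertex D`, given by its component at `vertex` and its
restriction to `D`. -/
noncomputable def natIsoMk {P Q : (WithVertex D)ᵒᵖ ⥤ T} (φ : P.obj (op vertex) ≅ Q.obj (op vertex))
    (ψ : incl.op ⋙ P ≅ incl.op ⋙ Q)
    (h : ∀ b c, P.map (endpoint b c).op ≫ φ.hom =
      ψ.hom.app (op c) ≫ Q.map (endpoint b c).op) :
    P ≅ Q :=
  have (X : (WithVertex D)ᵒᵖ) : IsIso ((natTransMk φ.hom ψ.hom h).app X) := by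
    obtain ⟨_ | c⟩ := X
    · exact inferInstanceAs (IsIso φ.hom)
    · exact inferInstanceAs (IsIso (ψ.hom.app (op c)))
  have := NatIso.isIso_of_isIso_app (natTransMk φ.hom ψ.hom h)
  asIso (natTransMk φ.hom ψ.hom h)

end

section HomPresheaf

variable (P : (WithVertex D)ᵒᵖ ⥤ Type w)

/-- The presheaf on `D` of elements of a presheaf on `WithVertex D` with given endpoints: these
are the hom objects of the graph corresponding to the presheaf. -/
def homPresheaf (a b : P.obj (op vertex)) : Dᵒᵖ ⥤ Type w where
  obj c := { x : P.obj (op (edge c.unop)) //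
    P.map (endpoint false c.unop).op x = a ∧ P.map (endpoint true c.unop).op x = b }
  map f := ↾fun x => ⟨P.map (incl.map f.unop).op x.1,
    (P.map_comp_apply _ _ _).symm.trans x.2.1, (P.map_comp_apply _ _ _).symm.trans x.2.2⟩
  map_id c := by
    ext x
    exact P.map_id_apply _ x.1
  map_comp f g := by
    ext x
    exact P.map_comp_apply (incl.map f.unop).op (incl.map g.unop).op x.1

variable {P} {Q : (WithVertex D)ᵒᵖ ⥤ Type w}

/-- The map on elements with given endpoints induced by a morphism of presheaves. -/
def homPresheafMap (φ : P ⟶ Q) (a b : P.obj (op vertex)) :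
    homPresheaf P a b ⟶ homPresheaf Q (φ.app _ a) (φ.app _ b) where
  app c := ↾fun x => ⟨φ.app _ x.1,
    (NatTrans.naturality_apply φ _ x.1).symm.trans (congr_arg _ x.2.1),
    (NatTrans.naturality_apply φ _ x.1).symm.trans (congr_arg _ x.2.2)⟩
  naturality c d f := by
    ext x
    refine Subtype.ext ?_
    exact NatTrans.naturality_apply φ (incl.map f.unop).op x.1

lemma homPresheaf_app_congr {f : P.obj (op vertex) → Q.obj (op vertex)}
    (φ : ∀ a b, homPresheaf P a b ⟶ homPresheaf Q (f a) (f b)) {c : Dᵒᵖ}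
    {a b : P.obj (op vertex)} (x : (homPresheaf P a b).obj c) :
    ((φ _ _).app c ⟨x.1, rfl, rfl⟩).1 = ((φ a b).app c x).1 := by
  obtain ⟨x, rfl, rfl⟩ := x
  rfl

/-- A morphism of presheaves on `WithVertex D`, given by its component at `vertex` and its effect on
elements with given endpoints. -/
def natTransOfHomPresheaf (f : P.obj (op vertex) → Q.obj (op vertex))
    (φ : ∀ a b, homPresheaf P a b ⟶ homPresheaf Q (f a) (f b)) : P ⟶ Q :=
  natTransMk (↾f)
    { app c := ↾fun x => ((φ _ _).app c ⟨x, rfl, rfl⟩).1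
      naturality c d g := by
        ext x
        exact (homPresheaf_app_congr φ ((homPresheaf P _ _).map g ⟨x, rfl, rfl⟩)).trans
          (congr_arg Subtype.val (NatTrans.naturality_apply (φ _ _) g ⟨x, rfl, rfl⟩)) }
    fun b c => by
      ext x
      cases b
      · exact ((φ _ _).app (op c) ⟨x, rfl, rfl⟩).2.1.symm
      · exact ((φ _ _).app (op c) ⟨x, rfl, rfl⟩).2.2.symm

lemma isIso_natTransOfHomPresheaf (f : P.obj (op vertex) ≃ Q.obj (op vertex))
    (φ : ∀ a b, homPresheaf P a b ⟶ homPresheaf Q (f a) (f b)) [∀ a b, IsIso (φ a b)] :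
    IsIso (natTransOfHomPresheaf f φ) := by
  have (X : (WithVertex D)ᵒᵖ) : IsIso ((natTransOfHomPresheaf f φ).app X) := by
    obtain ⟨_ | c⟩ := X
    · exact inferInstanceAs (IsIso f.toIso.hom)
    · rw [isIso_iff_bijective]
      have bijective_app (a b : P.obj (op vertex)) : Function.Bijective ((φ a b).app (op c)) :=
        (isIso_iff_bijective _).1 inferInstance
      refine ⟨fun x y hxy => ?_, fun y => ?_⟩
      · have map_endpoint_eq (b : Bool) :
            P.map (endpoint b c).op y = P.map (endpoint b c).op x :=
          f.injective ((NatTrans.naturality_apply (natTransOfHomPresheaf f φ)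
            (endpoint b c).op y).trans ((congr_arg _ hxy.symm).trans
              (NatTrans.naturality_apply (natTransOfHomPresheaf f φ) (endpoint b c).op x).symm))
        let y' : (homPresheaf P _ _).obj (op c) := ⟨y, map_endpoint_eq false, map_endpoint_eq true⟩
        exact congr_arg Subtype.val ((bijective_app _ _).injective
          (Subtype.ext (hxy.trans (homPresheaf_app_congr φ y'))))
      · obtain ⟨x, hx⟩ := (bijective_app _ _).surjective
          ⟨y, (f.apply_symm_apply _).symm, (f.apply_symm_apply _).symm⟩
        exact ⟨x.1, (homPresheaf_app_congr φ x).trans (congr_arg Subtype.val hx)⟩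
  exact NatIso.isIso_of_isIso_app _

end HomPresheaf

end WithVertex

namespace EnrichedGraph

open WithVertex

variable {V : Type u} [Category.{w} V]

section Nerve

universe v

variable {D : Type*} [Category.{v} D] (F : V ⥤ Dᵒᵖ ⥤ Type w)

/-- The presheaf on `WithVertex D` associated to a graph, relative to a functor `F` from `V` to
presheaves on `D`: its elements are the vertices of the graph and the elements of the presheaves
`F.obj (X.hom a b)`. -/
def nerve : EnrichedGraph.{w} V ⥤ (WithVertex D)ᵒᵖ ⥤ Type w :=
  (desc (op (vertices V)) (F.flip ⋙ edges).rightOp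
    fun b => { app c := (EnrichedGraph.endpoint (F.flip.obj (op c)) b).op }).leftOp.flip

lemma bijective_edge_mk {G : V ⥤ Type w} {X : EnrichedGraph.{w} V} (a b : X.obj) :
    Function.Bijective fun v : G.obj (X.hom a b) =>
      (⟨Edge.mk a b v, rfl, rfl⟩ : { e : Edge G X // e.src = a ∧ e.tgt = b }) := by
  refine ⟨fun v v' h => by simpa using h, ?_⟩
  rintro ⟨⟨a, b, v⟩, rfl, rfl⟩
  exact ⟨v, rfl⟩

/-- The elements of the nerve of a graph with given endpoints are the elements of the
corresponding hom object. -/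
noncomputable def homPresheafNerveIso (X : EnrichedGraph.{w} V) (a b : X.obj) :
    F.obj (X.hom a b) ≅ homPresheaf ((nerve F).obj X) a b :=
  NatIso.ofComponents
    (fun c => Equiv.toIso (Y := (homPresheaf ((nerve F).obj X) a b).obj c)
      (Equiv.ofBijective _ (bijective_edge_mk (G := F.flip.obj c) a b)))
    fun f => by
      ext v
      refine Subtype.ext ?_
      refine (congr_arg (Edge.mk a b) ?_).trans
        (Edge.map_mk_of_eq (F.flip.map f) (𝟙 X) (rfl : _ = a) (rfl : _ = b) v).symm
      have map_id : (F.flip.obj _).map (Hom.mapOfEq (𝟙 X) (rfl : _ = a) (rfl : _ = b)) v = v := by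
        rw [Hom.mapOfEq_id, Functor.map_id_apply]
      exact (congr_arg ((F.obj _).map f) map_id).symm

variable {F}

instance [F.Faithful] : (nerve F).Faithful where
  map_injective {X Y f g} h := by
    have hobj (a : X.obj) : f.obj a = g.obj a :=
      ConcreteCategory.congr_hom (NatTrans.congr_app h (op vertex)) a
    refine Hom.ext_mapOfEq hobj fun a b => F.map_injective ?_
    ext c v
    let G := F.flip.obj c
    exact (bijective_edge_mk (G := G) _ _).injective
      (Subtype.ext ((Edge.map_mk_of_eq (𝟙 G) f (hobj a) (hobj b) v).symm.trans
        (ConcreteCategory.congr_hom (NatTrans.congr_app h (op (edge c.unop))) (Edge.mk a b v))))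

instance [F.Full] : (nerve F).Full where
  map_surjective {X Y} φ := by
    let f : X ⟶ Y :=
      { obj := φ.app (op vertex)
        map a b := F.preimage ((homPresheafNerveIso F X a b).hom ≫
          homPresheafMap φ a b ≫ (homPresheafNerveIso F Y _ _).inv) }
    have hf (a b : X.obj) : F.map (f.map a b) ≫ (homPresheafNerveIso F Y _ _).hom =
        (homPresheafNerveIso F X a b).hom ≫ homPresheafMap φ a b := by
      simp [f]
    refine ⟨f, ?_⟩
    ext ⟨_ | c⟩ x
    · rfl
    · exact congr_arg Subtype.val (ConcreteCategory.congr_hom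
        (NatTrans.congr_app (hf x.src x.tgt) (op c)) x.val)

lemma essImage_nerve {P : (WithVertex D)ᵒᵖ ⥤ Type w}
    (hP : ∀ a b, F.essImage (homPresheaf P a b)) : (nerve F).essImage P := by
  let X : EnrichedGraph.{w} V :=
    { obj := P.obj (op vertex)
      hom a b := (hP a b).witness }
  let vertexEquiv : ((nerve F).obj X).obj (op vertex) ≃ P.obj (op vertex) := Equiv.refl _
  let φ (a b : X.obj) : homPresheaf ((nerve F).obj X) a b ≅
      homPresheaf P (vertexEquiv a) (vertexEquiv b) :=
    (homPresheafNerveIso F X a b).symm ≪≫ (hP a b).getIso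
  have := isIso_natTransOfHomPresheaf vertexEquiv fun a b => (φ a b).hom
  exact ⟨X, ⟨asIso (natTransOfHomPresheaf vertexEquiv fun a b => (φ a b).hom)⟩⟩

end Nerve

end EnrichedGraph

namespace WithVertex

section Topology

universe v

variable {D : Type*} [Category.{v} D]

/-- The sieve on an object of `D` in `WithVertex D` generated by a sieve in `D` and both
endpoints. -/
def extendSieve {c : D} (T : Sieve c) : Sieve (edge c) where
  arrows
    | vertex, _ => True
    | edge _, f => T.arrows f
  downward_closed {X Y f} hf g := by
    obtain _ | d := X <;> obtain _ | e := Y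
    exacts [trivial, g.elim, trivial, T.downward_closed hf g]

/-- The covering sieves on the objects of `WithVertex D`. -/
def coveringSieves (J : GrothendieckTopology D) : ∀ X : WithVertex D, Set (Sieve X)
  | vertex => {⊤}
  | edge c => {S | (∀ b, S.arrows (endpoint b c)) ∧ S.functorPullback incl (X := c) ∈ J c}

/-- The topology on `WithVertex D` associated to a topology on `D`: a sieve on an object of `D` is
covering when it contains both endpoints and its restriction to `D` is covering. -/
def topology (J : GrothendieckTopology D) : GrothendieckTopology (WithVertex D) where
  sieves := coveringSieves J
  top_mem' X := by
    obtain _ | c := X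
    · exact rfl
    · exact ⟨fun _ => trivial, J.top_mem c⟩
  pullback_stable' {X Y S} f hS := by
    induction f using hom_induction with
    | id =>
      obtain rfl : S = ⊤ := hS
      exact Sieve.pullback_top
    | endpoint b c => exact Sieve.id_mem_iff_eq_top.1 (hS.1 b)
    | incl f => exact ⟨fun b => hS.1 b, J.pullback_stable f hS.2⟩
  transitive' {X S} hS R hR := by
    obtain _ | c := X
    · obtain rfl : S = ⊤ := hS
      simpa using hR (f := 𝟙 _) trivial
    · refine ⟨fun b => ?_, J.transitive hS.2 _ (fun _ f hf => (hR hf).2)⟩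
      exact Sieve.id_mem_iff_eq_top.2 (hR (hS.1 b) : R.pullback (endpoint b c) = ⊤)

variable {J : GrothendieckTopology D} {P : (WithVertex D)ᵒᵖ ⥤ Type w}

lemma isSheafFor_of_homPresheaf {c : D} (S : Sieve (edge c)) (hS : ∀ b, S.arrows (endpoint b c))
    (h : ∀ a b, Presieve.IsSheafFor (homPresheaf P a b)
      (S.functorPullback incl (X := c)).arrows) :
    Presieve.IsSheafFor P S.arrows := by
  intro x hx
  rw [Presieve.compatible_iff_sieveCompatible] at hx
  have map_endpoint (b : Bool) {d : D} (f : d ⟶ c) (hf : S.arrows (incl.map f)) :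
      P.map (endpoint b d).op (x _ hf) = x _ (hS b) := (hx _ (endpoint b d) hf).symm
  let y : Presieve.FamilyOfElements (homPresheaf P (x _ (hS false)) (x _ (hS true)))
      (S.functorPullback incl (X := c)).arrows :=
    fun d f hf => ⟨x (incl.map f) hf, map_endpoint _ f hf, map_endpoint _ f hf⟩
  have hy : y.Compatible := by
    rw [Presieve.compatible_iff_sieveCompatible]
    exact fun _ _ f g hf => Subtype.ext (hx _ (incl.map g) hf)
  obtain ⟨t, ht, ht_unique⟩ := h _ _ y hy
  refine ⟨t.1, fun X f hf => ?_, fun t' ht' => ?_⟩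
  · obtain _ | d := X
    · obtain ⟨_ | _⟩ := f
      exacts [t.2.1, t.2.2]
    · exact congr_arg Subtype.val (ht f hf)
  · exact congr_arg Subtype.val (ht_unique ⟨t', ht' _ (hS false), ht' _ (hS true)⟩
      fun d f hf => Subtype.ext (ht' _ hf))

lemma homPresheaf_isSheafFor {c : D} (T : Sieve c)
    (h : Presieve.IsSheafFor P (extendSieve T).arrows) (a b : P.obj (op vertex)) :
    Presieve.IsSheafFor (homPresheaf P a b) T.arrows := by
  intro x hx
  rw [Presieve.compatible_iff_sieveCompatible] at hx
  let y : Presieve.FamilyOfElements P (extendSieve T).arrows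
    | vertex, ⟨false⟩, _ => a
    | vertex, ⟨true⟩, _ => b
    | edge _, f, hf => (x f hf).1
  have hy : y.Compatible := by
    rw [Presieve.compatible_iff_sieveCompatible]
    intro X Y f g hf
    induction g using hom_induction with
    | id => exact (Functor.map_id_apply P _ _).symm
    | endpoint b d =>
      cases b
      exacts [(x f hf).2.1.symm, (x f hf).2.2.symm]
    | incl g => exact congr_arg Subtype.val (hx f g hf)
  obtain ⟨t, ht, ht_unique⟩ := h y hy
  refine ⟨⟨t, ht (endpoint false c) trivial, ht (endpoint true c) trivial⟩,
    fun d f hf => Subtype.ext (ht (incl.map f) hf),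
    fun t' ht' => Subtype.ext (ht_unique _ fun X f hf => ?_)⟩
  obtain _ | d := X
  · obtain ⟨_ | _⟩ := f
    exacts [t'.2.1, t'.2.2]
  · exact congr_arg Subtype.val (ht' f hf)

lemma isSheaf_topology_iff :
    Presheaf.IsSheaf (topology J) P ↔ ∀ a b, Presheaf.IsSheaf J (homPresheaf P a b) := by
  simp only [isSheaf_iff_isSheaf_of_type]
  refine ⟨fun h a b c T hT => homPresheaf_isSheafFor T (h _ ⟨fun _ => trivial, hT⟩) a b,
    fun h X S hS => ?_⟩
  obtain _ | c := X
  · obtain rfl : S = ⊤ := hS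
    exact Presieve.isSheafFor_top _
  · exact isSheafFor_of_homPresheaf S hS.1 fun a b => h a b _ hS.2

end Topology

end WithVertex

namespace EnrichedGraph

open WithVertex

variable {V : Type u} [Category.{w} V]

theorem isPresheafTopos (h : IsPresheafTopos V) : IsPresheafTopos (EnrichedGraph.{w} V) := by
  obtain ⟨D, _, ⟨e⟩⟩ := h
  have : (nerve e.functor).EssSurj :=
    ⟨fun _ => essImage_nerve fun _ _ => Functor.EssSurj.mem_essImage e.functor _⟩
  have : (nerve e.functor).IsEquivalence := { }
  exact ⟨WithVertex D, inferInstance, ⟨(nerve e.functor).asEquivalence⟩⟩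

section Sheaf

variable {D : Type w} [SmallCategory D] {J : GrothendieckTopology D}

/-- The nerve of a graph enriched in a category of sheaves. -/
noncomputable def sheafNerve (F : V ⥤ Sheaf J (Type w)) :
    EnrichedGraph.{w} V ⥤ Sheaf (topology J) (Type w) :=
  ObjectProperty.lift _ (nerve (F ⋙ sheafToPresheaf J (Type w))) fun X =>
    isSheaf_topology_iff.2 fun a b =>
      (Presheaf.isSheaf_of_iso_iff (homPresheafNerveIso _ X a b)).1 (F.obj (X.hom a b)).property

instance (F : V ⥤ Sheaf J (Type w)) [F.IsEquivalence] : (sheafNerve F).IsEquivalence where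
  faithful := inferInstanceAs (ObjectProperty.lift _ _ _).Faithful
  full := inferInstanceAs (ObjectProperty.lift _ _ _).Full
  essSurj.mem_essImage P := by
    have hP (a b : P.obj.obj (op vertex)) :
        (F ⋙ sheafToPresheaf J (Type w)).essImage (homPresheaf P.obj a b) := by
      let Q : Sheaf J (Type w) := ⟨homPresheaf P.obj a b, isSheaf_topology_iff.1 P.property a b⟩
      exact ⟨F.objPreimage Q, ⟨(sheafToPresheaf J (Type w)).mapIso (F.objObjPreimageIso Q)⟩⟩
    obtain ⟨X, ⟨i⟩⟩ := essImage_nerve hP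
    exact ⟨X, ⟨(fullyFaithfulSheafToPresheaf _ _).preimageIso i⟩⟩

end Sheaf

theorem isGrothendieckTopos (h : IsGrothendieckTopos V) :
    IsGrothendieckTopos (EnrichedGraph.{w} V) := by
  obtain ⟨D, _, J, ⟨e⟩⟩ := h
  exact ⟨WithVertex D, inferInstance, topology J, ⟨(sheafNerve e.functor).asEquivalence⟩⟩

end EnrichedGraph

section Density

universe v

variable {C : Type u} [Category.{w} C] {D : Type*} [Category.{v} D]

/-- The functor sending an object `X` to the presheaf `d ↦ (K.obj d ⟶ X)`. Unlike
`Presheaf.restrictedULiftYoneda`, it involves no universe lifting. -/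
abbrev restrictedYoneda (K : D ⥤ C) : C ⥤ Dᵒᵖ ⥤ Type w := (K.op ⋙ coyoneda).flip

/-- The comparison between the two versions of the restricted Yoneda functor. -/
def restrictedULiftYonedaIso (K : D ⥤ C) :
    Presheaf.restrictedULiftYoneda.{0} K ≅ restrictedYoneda K :=
  NatIso.ofComponents fun _ => NatIso.ofComponents fun _ => Equiv.ulift.toIso

instance (K : D ⥤ C) [K.IsDense] : (restrictedYoneda K).Faithful :=
  .of_iso (restrictedULiftYonedaIso K)

instance (K : D ⥤ C) [K.IsDense] : (restrictedYoneda K).Full :=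
  .of_iso (restrictedULiftYonedaIso K)

lemma isDense_of_restrictedYoneda (K : D ⥤ C) [(restrictedYoneda K).Full]
    [(restrictedYoneda K).Faithful] : K.IsDense where
  isDenseAt X := by
    let φ (s : Cocone (CostructuredArrow.proj K X ⋙ K)) :
        (restrictedYoneda K).obj X ⟶ (restrictedYoneda K).obj s.pt :=
      { app d := ↾fun p => s.ι.app (.mk p)
        naturality d d' g := by
          ext p
          let γ : CostructuredArrow.mk (K.map g.unop ≫ p) ⟶ CostructuredArrow.mk p :=
            CostructuredArrow.homMk g.unop
          exact (s.w γ).symm }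
    have comp_preimage (s : Cocone (CostructuredArrow.proj K X ⋙ K)) {d : D} (p : K.obj d ⟶ X) :
        p ≫ (restrictedYoneda K).preimage (φ s) = s.ι.app (.mk p) :=
      ConcreteCategory.congr_hom
        (NatTrans.congr_app ((restrictedYoneda K).map_preimage (φ s)) (op d)) p
    exact ⟨
      { desc s := (restrictedYoneda K).preimage (φ s)
        fac s j := (congr_arg (· ≫ _) (Category.id_comp j.hom)).trans (comp_preimage s j.hom)
        uniq s m hm := (restrictedYoneda K).map_injective <| by
          ext d p
          exact ((congr_arg (· ≫ m) (Category.id_comp p)).symm.trans (hm (.mk p))).trans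
            (comp_preimage s p).symm }⟩

lemma hom_ext_of_isDense (K : D ⥤ C) [K.IsDense] {X Y : C} {f g : X ⟶ Y}
    (h : ∀ (d : D) (p : K.obj d ⟶ X), p ≫ f = p ≫ g) : f = g :=
  (restrictedYoneda K).map_injective <| by ext d p; exact h d.unop p

lemma exists_hom_of_isDense (K : D ⥤ C) [K.IsDense] {X Y : C}
    (φ : (restrictedYoneda K).obj X ⟶ (restrictedYoneda K).obj Y) :
    ∃ f : X ⟶ Y, ∀ (d : D) (p : K.obj d ⟶ X), p ≫ f = φ.app (op d) p :=
  ⟨(restrictedYoneda K).preimage φ, fun d p => ConcreteCategory.congr_hom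
    (NatTrans.congr_app ((restrictedYoneda K).map_preimage φ) (op d)) p⟩

lemma isDense_of_hom {K : D ⥤ C}
    (hom_ext : ∀ {X Y : C} {f g : X ⟶ Y},
      (∀ (d : D) (p : K.obj d ⟶ X), p ≫ f = p ≫ g) → f = g)
    (exists_hom : ∀ {X Y : C} (φ : (restrictedYoneda K).obj X ⟶ (restrictedYoneda K).obj Y),
      ∃ f : X ⟶ Y, ∀ (d : D) (p : K.obj d ⟶ X), p ≫ f = φ.app (op d) p) :
    K.IsDense :=
  have : (restrictedYoneda K).Faithful :=
    { map_injective h := hom_ext fun d p =>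
        ConcreteCategory.congr_hom (NatTrans.congr_app h (op d)) p }
  have : (restrictedYoneda K).Full :=
    { map_surjective φ := by
        obtain ⟨f, hf⟩ := exists_hom φ
        exact ⟨f, by ext d p; exact hf d.unop p⟩ }
  isDense_of_restrictedYoneda K

lemma isDense_of_comp {E : Type*} [Category* E] (L : E ⥤ D) (K : D ⥤ C) [K.Full]
    [(L ⋙ K).IsDense] : K.IsDense :=
  isDense_of_hom (fun h => hom_ext_of_isDense (L ⋙ K) fun e => h (L.obj e)) fun {X Y} φ => by
    obtain ⟨f, hf⟩ := exists_hom_of_isDense (L ⋙ K) (Functor.whiskerLeft L.op φ)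
    refine ⟨f, fun d p => hom_ext_of_isDense (L ⋙ K) fun e g => ?_⟩
    obtain ⟨g, rfl⟩ := K.map_surjective g
    exact (Category.assoc _ _ _).symm.trans
      ((hf e (K.map g ≫ p)).trans (NatTrans.naturality_apply φ g.op p))

/-- The objects satisfying `P` without morphisms to the initial object. -/
def nonInitial [HasInitial C] (P : ObjectProperty C) : ObjectProperty C :=
  P ⊓ fun X => IsEmpty (X ⟶ ⊥_ C)

section StrictInitial

variable [HasInitial C] [HasStrictInitialObjects C] {P : ObjectProperty C} {X Y : C}

lemma hom_ext_of_nonempty_hom_initial {A : C} (hA : ¬ IsEmpty (A ⟶ ⊥_ C)) (p q : A ⟶ X) :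
    p = q := by
  obtain ⟨t⟩ := not_isEmpty_iff.1 hA
  exact (initialIsInitial.ofStrict t).hom_ext p q

lemma existsUnique_hom_comp_eq_app
    (φ : (restrictedYoneda (nonInitial P).ι).obj X ⟶ (restrictedYoneda (nonInitial P).ι).obj Y)
    {A : C} (hA : P A) (p : A ⟶ X) :
    ∃! q : A ⟶ Y, ∀ (B : (nonInitial P).FullSubcategory) (u : B.obj ⟶ A),
      u ≫ q = φ.app (op B) (u ≫ p) := by
  by_cases isEmpty_hom : IsEmpty (A ⟶ ⊥_ C)
  · let A' : (nonInitial P).FullSubcategory := ⟨A, hA, isEmpty_hom⟩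
    refine ⟨φ.app (op A') p, fun B u => ?_, fun q hq => ?_⟩
    · exact (NatTrans.naturality_apply φ (Quiver.Hom.op (ObjectProperty.homMk u : B ⟶ A')) p).symm
    · exact (Category.id_comp q).symm.trans
        ((hq A' (𝟙 A)).trans (congr_arg (φ.app (op A')) (Category.id_comp p)))
  · obtain ⟨t⟩ := not_isEmpty_iff.1 isEmpty_hom
    exact ⟨t ≫ initial.to Y, fun B u => (B.property.2.false (u ≫ t)).elim,
      fun q _ => hom_ext_of_nonempty_hom_initial isEmpty_hom _ _⟩

instance isDense_nonInitial [P.ι.IsDense] : (nonInitial P).ι.IsDense := by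
  refine isDense_of_hom (fun {X Y f g} h => hom_ext_of_isDense P.ι fun A p => ?_)
    fun {X Y} φ => ?_
  · by_cases hA : IsEmpty (A.obj ⟶ ⊥_ C)
    · exact h ⟨A.obj, A.property, hA⟩ p
    · exact hom_ext_of_nonempty_hom_initial hA _ _
  · choose ψ hψ hψ_unique using fun A : P.FullSubcategory =>
      existsUnique_hom_comp_eq_app φ A.property
    obtain ⟨f, hf⟩ := exists_hom_of_isDense P.ι (X := X) (Y := Y)
      { app A := ↾(ψ A.unop)
        naturality A B g := by
          ext p
          exact (hψ_unique _ _ _ fun D u => (Category.assoc _ _ _).symm.trans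
            ((hψ A.unop p D (u ≫ g.unop.hom)).trans
              (congr_arg (φ.app (op D)) (Category.assoc _ _ _)))).symm }
    refine ⟨f, fun B p => ?_⟩
    let A : P.FullSubcategory := ⟨B.obj, B.property.1⟩
    exact (hf A p).trans ((Category.id_comp (ψ A p)).symm.trans
      ((hψ A p B (𝟙 A.obj)).trans (congr_arg (φ.app (op B)) (Category.id_comp p))))

end StrictInitial

end Density

namespace EnrichedGraph

open WithVertex

section Density

universe v

variable {V : Type u} [Category.{w} V] [HasInitial V] {D : Type*} [Category.{v} D] (i : D ⥤ V)

/-- The functor sending `vertex` to `point V` and an object of `D` to the corresponding edge. -/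
noncomputable def generator : WithVertex D ⥤ EnrichedGraph.{w} V :=
  desc (point V) (i ⋙ edgeGraph) fun b =>
    { app c := (pointHomEquiv (edgeGraph.obj (i.obj c))).symm ⟨b⟩
      naturality _ _ _ := (pointHomEquiv (edgeGraph.obj (i.obj _))).injective rfl }

/-- Morphisms from the generators are vertices and edges. -/
noncomputable def restrictedYonedaGeneratorIso :
    restrictedYoneda (generator i) ≅ nerve (restrictedYoneda i) :=
  (flipFunctor _ _ _).mapIso <| natIsoMk (P := (generator i).op ⋙ coyoneda) coyonedaPointIso
    (Functor.isoWhiskerLeft i.op coyonedaEdgeGraphIso) fun b c => by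
      ext X g
      obtain _ | _ := b <;> rfl

instance [i.IsDense] : (generator i).IsDense :=
  have := Functor.Full.of_iso (restrictedYonedaGeneratorIso i).symm
  have := Functor.Faithful.of_iso (restrictedYonedaGeneratorIso i).symm
  isDense_of_restrictedYoneda (generator i)

end Density

end EnrichedGraph

section ConnectedObjects

variable {C : Type u} [Category.{w} C]

/-- The map sending a morphism from `X` to a member of a cofan to its composite with the
injection. The object `X` is connected when this map is bijective for all coproduct cofans. -/
def compInj (X : C) {I : Type w} {Y : I → C} (d : Cofan Y) (f : Σ i, X ⟶ Y i) : X ⟶ d.pt :=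
  f.2 ≫ d.inj f.1

lemma isConnectedObject_iff (X : C) : isConnectedObject C X ↔
    ∀ {I : Type w} {Y : I → C} {d : Cofan Y}, IsColimit d → Function.Bijective (compInj X d) := by
  have nonempty_isColimit_iff {I : Type w} (Y : I → C) (d : Cofan Y) :
      Nonempty (IsColimit ((coyoneda.obj (op X)).mapCocone d)) ↔
        Function.Bijective (compInj X d) := by
    rw [(Cofan.isColimitMapCoconeEquiv (coyoneda.obj (op X)) Y d).nonempty_congr]
    exact Cofan.nonempty_isColimit_iff_bijective_fromSigma _
  refine ⟨fun hX I Y d hd => ?_, fun bijective_compInj I => { preservesColimit {K} := ?_ }⟩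
  · have := hX I
    exact (nonempty_isColimit_iff Y d).1 ⟨isColimitOfPreserves (coyoneda.obj (op X)) hd⟩
  · have : PreservesColimit (Discrete.functor (K.obj ∘ Discrete.mk)) (coyoneda.obj (op X)) :=
      ⟨fun {d} hd => (nonempty_isColimit_iff _ d).2 (bijective_compInj hd)⟩
    exact preservesColimit_of_iso_diagram _ Discrete.natIsoFunctor.symm

lemma isEmpty_hom_of_isConnectedObject {X T : C} (hX : isConnectedObject C X) (hT : IsInitial T) :
    IsEmpty (X ⟶ T) := by
  let d : Cofan (fun i : PEmpty.{w + 1} => (i.elim : C)) := Cofan.mk T (fun i => i.elim)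
  have hd : IsColimit d := Cofan.IsColimit.mk _ (fun _ => hT.to _) (fun _ i => i.elim)
    (fun _ _ _ => hT.hom_ext _ _)
  refine ⟨fun f => ?_⟩
  obtain ⟨⟨i, _⟩, _⟩ := ((isConnectedObject_iff X).1 hX hd).surjective f
  exact i.elim

section

variable {A : Type w} [SmallCategory A] [IsConnected A] {K : A ⥤ C} {c : Cocone K}
  {I : Type w} {Y : I → C} {d : Cofan Y}

lemma injective_compInj_of_isColimit (hc : IsColimit c)
    (hK : ∀ a, Function.Injective (compInj (K.obj a) d)) :
    Function.Injective (compInj c.pt d) := by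
  rintro ⟨i, f⟩ ⟨j, g⟩ hfg
  have mk_comp_eq (a : A) :
      (⟨i, c.ι.app a ≫ f⟩ : Σ i, K.obj a ⟶ Y i) = ⟨j, c.ι.app a ≫ g⟩ :=
    hK a <| (Category.assoc _ _ _).trans <|
      (congr_arg (c.ι.app a ≫ ·) hfg).trans (Category.assoc _ _ _).symm
  obtain rfl : i = j := congr_arg Sigma.fst (mk_comp_eq (Classical.arbitrary A))
  obtain rfl : f = g := hc.hom_ext fun a => eq_of_heq (Sigma.mk.inj (mk_comp_eq a)).2
  rfl

lemma surjective_compInj_of_isColimit (hc : IsColimit c)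
    (hK : ∀ a, Function.Bijective (compInj (K.obj a) d)) :
    Function.Surjective (compInj c.pt d) := by
  intro f
  choose φ hφ using fun a => (hK a).surjective (c.ι.app a ≫ f)
  have hφ_map {a b : A} (u : a ⟶ b) : φ a = ⟨(φ b).1, K.map u ≫ (φ b).2⟩ :=
    (hK a).injective <| (hφ a).trans <| (c.w_assoc u f).symm.trans <|
      (congr_arg (K.map u ≫ ·) (hφ b)).symm.trans (Category.assoc _ _ _).symm
  obtain ⟨i, hi⟩ := constant_of_preserves_morphisms' (fun a => (φ a).1)
    fun a b u => congr_arg Sigma.fst (hφ_map u)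
  have exists_factorization (a : A) : ∃ g : K.obj a ⟶ Y i, φ a = ⟨i, g⟩ := by
    obtain rfl := hi a
    exact ⟨(φ a).2, rfl⟩
  choose g hg using exists_factorization
  let s : Cocone K :=
    { pt := Y i
      ι :=
        { app := g
          naturality a b u := by
            have := hφ_map u
            rw [hg a, hg b] at this
            exact (eq_of_heq (Sigma.mk.inj this).2).symm.trans (Category.comp_id _).symm } }
  refine ⟨⟨i, hc.desc s⟩, hc.hom_ext fun a => ?_⟩
  exact (hc.fac_assoc s a (d.inj i)).trans ((congr_arg (compInj _ d) (hg a)).symm.trans (hφ a))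

instance isClosedUnderColimitsOfShape_isConnectedObject :
    (isConnectedObject C).IsClosedUnderColimitsOfShape A where
  colimitsOfShape_le := by
    rintro X ⟨p⟩
    refine (isConnectedObject_iff X).2 fun {I Y d} hd => ?_
    have hK (a : A) : Function.Bijective (compInj (p.diag.obj a) d) :=
      (isConnectedObject_iff _).1 (p.prop_diag_obj a) hd
    exact ⟨injective_compInj_of_isColimit p.isColimit fun a => (hK a).injective,
      surjective_compInj_of_isColimit p.isColimit hK⟩

end

lemma exists_small_isDense (P : ObjectProperty C) [ObjectProperty.EssentiallySmall.{w} P]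
    [P.ι.IsDense] : ∃ (Q : ObjectProperty C) (_ : ObjectProperty.Small.{w} Q),
      Q ≤ P ∧ Q.ι.IsDense := by
  obtain ⟨Q, _, hQP, hPQ⟩ := ObjectProperty.EssentiallySmall.exists_small_le P
  have := (ObjectProperty.isEquivalence_ιOfLE_iff hQP).2 hPQ
  exact ⟨Q, inferInstance, hQP, inferInstanceAs (ObjectProperty.ιOfLE hQP ⋙ P.ι).IsDense⟩

variable (C) in
lemma hasInitial_of_hasColimitsOfSize [HasColimitsOfSize.{w, w} C] : HasInitial C :=
  have := hasColimitsOfSizeShrink.{0, 0, w, w} C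
  inferInstance

variable {κ : Cardinal.{w}} [Fact κ.IsRegular]

lemma isCardinalLocallyPresentable_of_isDense [HasColimitsOfSize.{w, w} C] {D : Type*}
    [Category* D] [Small.{w} D] (K : D ⥤ C) [K.IsDense]
    (hK : ∀ d, IsCardinalPresentable (K.obj d) κ) : IsCardinalLocallyPresentable C κ :=
  (IsCardinalLocallyPresentable.iff_exists_isStrongGenerator C κ).2
    ⟨.ofObj K.obj, inferInstance, Functor.isStrongGenerator_of_isDense K,
      (ObjectProperty.ofObj_le_iff _ _).2 hK⟩

lemma isCardinalLocallyPresentable_of_cPresentable (h : IsCardinalLocallyCPresentable C κ) :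
    IsCardinalLocallyPresentable C κ := by
  obtain ⟨S, _, -, presentable, exists_colimit⟩ := h.exists_generator
  have := h.toHasColimitsOfSize
  refine (IsCardinalLocallyPresentable.iff_exists_isStrongGenerator C κ).2 ⟨S, inferInstance,
    ObjectProperty.IsStrongGenerator.mk_of_exists_colimitsOfShape.{w} fun X => ?_, presentable⟩
  obtain ⟨J, _, _, hJ⟩ := exists_colimit X
  exact ⟨J, inferInstance, hJ⟩

-- An object mapping to an initial one is a colimit of connected objects, none of which maps to an
-- initial object, so that the colimit is empty.
lemma hasStrictInitialObjects_of_cPresentable (h : IsCardinalLocallyCPresentable C κ) :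
    HasStrictInitialObjects C where
  out {I A} f hI := by
    obtain ⟨S, _, connected, -, exists_colimit⟩ := h.exists_generator
    obtain ⟨J, _, _, ⟨p⟩⟩ := exists_colimit A
    have : IsEmpty J := ⟨fun j => (isEmpty_hom_of_isConnectedObject
      (connected _ (p.prop_diag_obj j)) hI).false (p.ι.app j ≫ f)⟩
    have hA : IsInitial A := IsInitial.ofUniqueHom
      (fun X => p.isColimit.desc ⟨X, { app j := isEmptyElim j, naturality j := isEmptyElim j }⟩)
      (fun X m => p.isColimit.hom_ext (fun j => isEmptyElim j))
    exact ⟨hI.to _, hA.hom_ext _ _, hI.hom_ext _ _⟩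

lemma isCardinalCFiltered_of_equivalence {J : Type w} [SmallCategory J] {E : Type*} [Category* E]
    (e : E ≌ J) (hasColimitsOfShape : ∀ (A : Type w) [SmallCategory A] [IsConnected A],
      HasCardinalLT (Arrow A) κ → HasColimitsOfShape A E) : IsCardinalCFiltered J κ where
  nonempty_cocone {A _ _} F hA :=
    have := hasColimitsOfShape A hA
    ⟨e.inverse.mapCoconeInv (colimit.cocone (F ⋙ e.inverse))⟩

lemma isCardinalLocallyCPresentable_of_isDense [HasColimitsOfSize.{w, w} C]
    [ObjectProperty.EssentiallySmall.{w} (isCardinalPresentable C κ)]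
    [(isConnectedObject C ⊓ isCardinalPresentable C κ).ι.IsDense] :
    IsCardinalLocallyCPresentable C κ where
  exists_generator := by
    let W : ObjectProperty C := isConnectedObject C ⊓ isCardinalPresentable C κ
    have hasColimitsOfShape (X : C) (A : Type w) [SmallCategory A] [IsConnected A]
        (hA : HasCardinalLT (Arrow A) κ) : HasColimitsOfShape A (CostructuredArrow W.ι X) :=
      have := isClosedUnderColimitsOfShape_isCardinalPresentable.{w} C hA
      have : W.IsClosedUnderColimitsOfShape A :=
        ⟨fun Y ⟨p⟩ => ⟨ObjectProperty.prop_of_isColimit _ p.isColimit fun a =>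
            (p.prop_diag_obj a).1,
          ObjectProperty.prop_of_isColimit _ p.isColimit fun a => (p.prop_diag_obj a).2⟩⟩
      inferInstance
    have : ObjectProperty.EssentiallySmall.{w} W :=
      ObjectProperty.EssentiallySmall.of_le inf_le_right
    obtain ⟨Q, _, hQW, hWQ⟩ := ObjectProperty.EssentiallySmall.exists_small_le W
    refine ⟨Q, inferInstance, hQW.trans inf_le_left, hQW.trans inf_le_right, fun X => ?_⟩
    let e := equivSmallModel.{w} (CostructuredArrow W.ι X)
    refine ⟨SmallModel.{w} (CostructuredArrow W.ι X), inferInstance,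
      isCardinalCFiltered_of_equivalence e (hasColimitsOfShape X), ?_⟩
    rw [← ObjectProperty.colimitsOfShape_isoClosure]
    exact ObjectProperty.colimitsOfShape_monotone _ hWQ _ ⟨
      { diag := _
        ι := _
        isColimit := (W.ι.denseAt X).whiskerEquivalence e.symm
        prop_diag_obj j := (e.inverse.obj j).left.property }⟩

end ConnectedObjects

namespace EnrichedGraph

open WithVertex

variable {V : Type u} [Category.{w} V] {κ : Cardinal.{w}} [Fact κ.IsRegular]

theorem isCardinalLocallyPresentable (h : IsCardinalLocallyPresentable V κ) :
    IsCardinalLocallyPresentable (EnrichedGraph.{w} V) κ := by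
  have := hasInitial_of_hasColimitsOfSize V
  obtain ⟨Q, _, hQ, _⟩ := exists_small_isDense (isCardinalPresentable V κ)
  refine isCardinalLocallyPresentable_of_isDense (generator Q.ι) fun
    | vertex => isCardinalPresentable_point κ
    | edge C =>
      have : IsCardinalPresentable C.obj κ := hQ _ C.property
      isCardinalPresentable_edgeGraph κ C.obj

theorem isCardinalLocallyCPresentable (h : IsCardinalLocallyPresentable V κ)
    (hV : HasStrictInitialObjects V) :
    IsCardinalLocallyCPresentable (EnrichedGraph.{w} V) κ := by
  have := hasInitial_of_hasColimitsOfSize V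
  have := isCardinalLocallyPresentable h
  let W := isConnectedObject (EnrichedGraph.{w} V) ⊓ isCardinalPresentable (EnrichedGraph.{w} V) κ
  have generator_mem : ∀ X, W ((generator (nonInitial (isCardinalPresentable V κ)).ι).obj X)
    | vertex => ⟨isConnectedObject_point, isCardinalPresentable_point κ⟩
    | edge C =>
      have : IsCardinalPresentable C.obj κ := C.property.1
      ⟨isConnectedObject_edgeGraph C.property.2, isCardinalPresentable_edgeGraph κ C.obj⟩
  have : (W.lift _ generator_mem ⋙ W.ι).IsDense :=
    inferInstanceAs (generator (nonInitial (isCardinalPresentable V κ)).ι).IsDense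
  have : W.ι.IsDense := isDense_of_comp (W.lift _ generator_mem) W.ι
  exact isCardinalLocallyCPresentable_of_isDense

lemma hasStrictInitialObjects : HasStrictInitialObjects (EnrichedGraph.{w} V) where
  out {I A} f hI := by
    let empty : EnrichedGraph.{w} V := { obj := PEmpty, hom a := a.elim }
    have hI_obj : IsEmpty I.obj := ⟨fun a => ((hI.to empty).obj a).elim⟩
    have hA_obj : IsEmpty A.obj := ⟨fun a => hI_obj.false (f.obj a)⟩
    have hom_ext {X Y : EnrichedGraph.{w} V} (_ : IsEmpty X.obj) (f g : X ⟶ Y) : f = g :=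
      Hom.ext_mapOfEq (fun a => isEmptyElim a) (fun a => isEmptyElim a)
    exact ⟨hI.to _, hom_ext hA_obj _ _, hom_ext hI_obj _ _⟩

end EnrichedGraph

section Subterminal

variable (C : Type u) [Category.{w} C] [HasTerminal C] [HasInitial C]

open Classical in
/-- The subobject of the terminal object associated to a proposition: terminal if it holds,
initial otherwise. -/
noncomputable def subterminal (p : Prop) : C :=
  if p then ⊤_ C else ⊥_ C

variable {C} {p : Prop}

/-- The object `subterminal C p` is terminal if `p` holds. -/
noncomputable def isTerminalSubterminal (hp : p) : IsTerminal (subterminal C p) :=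
  terminalIsTerminal.ofIso (eqToIso (if_pos hp).symm)

/-- The object `subterminal C p` is initial if `p` does not hold. -/
noncomputable def isInitialSubterminal (hp : ¬ p) : IsInitial (subterminal C p) :=
  initialIsInitial.ofIso (eqToIso (if_neg hp).symm)

open Classical in
/-- Morphisms from `subterminal C p` are families of global elements indexed by proofs of `p`. -/
noncomputable def subterminalHomEquiv (X : C) : (subterminal C p ⟶ X) ≃ (p → (⊤_ C ⟶ X)) where
  toFun f hp := (isTerminalSubterminal hp).from _ ≫ f
  invFun g := if hp : p then terminal.from _ ≫ g hp else (isInitialSubterminal hp).to X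
  left_inv f := by
    split_ifs with hp
    · beta_reduce
      rw [← Category.assoc, (isTerminalSubterminal hp).hom_ext (_ ≫ _) (𝟙 _), Category.id_comp]
    · exact (isInitialSubterminal hp).hom_ext _ _
  right_inv g := by
    funext hp
    beta_reduce
    rw [dif_pos hp, ← Category.assoc, terminalIsTerminal.hom_ext (_ ≫ _) (𝟙 _), Category.id_comp]

lemma subterminalHomEquiv_comp {X Y : C} (f : subterminal C p ⟶ X) (g : X ⟶ Y) (hp : p) :
    subterminalHomEquiv Y (f ≫ g) hp = subterminalHomEquiv X f hp ≫ g :=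
  (Category.assoc _ _ _).symm

lemma nonempty_hom_subterminal {X : C} (h : IsEmpty (X ⟶ ⊥_ C) → p) :
    Nonempty (X ⟶ subterminal C p) := by
  by_cases hX : IsEmpty (X ⟶ ⊥_ C)
  · exact ⟨(isTerminalSubterminal (h hX)).from X⟩
  · obtain ⟨t⟩ := not_isEmpty_iff.1 hX
    exact ⟨t ≫ initial.to _⟩

lemma of_hom_subterminal {X : C} (f : X ⟶ subterminal C p) (hX : IsEmpty (X ⟶ ⊥_ C)) : p := by
  by_contra hp
  exact hX.false (f ≫ (isInitialSubterminal hp).to _)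

instance [HasStrictInitialObjects C] {X : C} : Subsingleton (X ⟶ subterminal C p) := by
  by_cases hp : p
  · exact ⟨(isTerminalSubterminal hp).hom_ext⟩
  · exact (isInitialSubterminal hp).subsingleton_to

end Subterminal

lemma hasStrictInitialObjects_of_equivalence {C D : Type*} [Category* C] [Category* D] (e : C ≌ D)
    [HasStrictInitialObjects D] : HasStrictInitialObjects C where
  out f hI := by
    have := (hI.isInitialObj e.functor).isIso_to (e.functor.map f)
    exact isIso_of_reflects_iso f e.functor

namespace EnrichedGraph

variable {V : Type u} [Category.{w} V]

section Discrete

variable [HasTerminal V]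

variable (V) in
/-- The terminal graph. -/
noncomputable def terminalGraph : EnrichedGraph.{w} V where
  obj := PUnit
  hom _ _ := ⊤_ V

/-- The graph `terminalGraph V` is terminal. -/
noncomputable def isTerminalTerminalGraph : IsTerminal (terminalGraph.{w} V) :=
  IsTerminal.ofUniqueHom (fun _ => { obj _ := ⟨⟩, map _ _ := terminal.from _ })
    fun _ _ => Hom.ext_mapOfEq (fun _ => rfl) fun _ _ => terminalIsTerminal.hom_ext _ _

variable [HasInitial V]

variable (V) in
/-- The discrete graph on a set: the coproduct of copies of the terminal graph. -/
noncomputable def discreteGraph (I : Type w) : EnrichedGraph.{w} V where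
  obj := I
  hom i j := subterminal V (i = j)

/-- Morphisms from `discreteGraph V I` are families of morphisms from the terminal graph. -/
noncomputable def discreteGraphHomEquiv (I : Type w) (X : EnrichedGraph.{w} V) :
    (discreteGraph V I ⟶ X) ≃ (I ⟶ (coyoneda.obj (op (terminalGraph V))).obj X) where
  toFun f := ↾fun i =>
    { obj _ := f.obj i
      map _ _ := subterminalHomEquiv _ (f.map i i) rfl }
  invFun g :=
    { obj i := (g i).obj ⟨⟩
      map i j := (subterminalHomEquiv (p := i = j) _).symm fun h => by
        subst h
        exact (g i).map ⟨⟩ ⟨⟩ }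
  left_inv f := Hom.ext rfl <| heq_of_eq <| by
    funext i j
    refine (Equiv.symm_apply_eq _).2 ?_
    funext h
    obtain rfl : i = j := h
    rfl
  right_inv g := by
    ext i
    refine Hom.ext rfl <| heq_of_eq ?_
    funext _ _
    exact congr_fun (Equiv.apply_symm_apply (subterminalHomEquiv (p := i = i) _) _) rfl

variable (V) in
/-- The functor sending a set to the discrete graph on it. -/
noncomputable def discrete : Type w ⥤ EnrichedGraph.{w} V :=
  Adjunction.leftAdjointOfEquiv discreteGraphHomEquiv fun _ _ _ _ _ => by
    ext i
    refine Hom.ext rfl <| heq_of_eq ?_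
    funext _ _
    exact subterminalHomEquiv_comp _ _ _

variable (V) in
/-- The discrete graph functor is left adjoint to the global sections functor. -/
noncomputable def discreteAdjunction :
    discrete V ⊣ coyoneda.obj (op (terminalGraph.{w} V)) :=
  Adjunction.adjunctionOfEquivLeft _ _

/-- The connected components of a graph: the quotient of the set of vertices by the equivalence
relation generated by the existence of a non-initial hom object. -/
def components (X : EnrichedGraph.{w} V) : Type w :=
  Quot fun a b : X.obj => IsEmpty (X.hom a b ⟶ ⊥_ V)

variable [HasStrictInitialObjects V]

lemma discrete_hom_ext {X : EnrichedGraph.{w} V} {I : Type w} {f g : X ⟶ (discrete V).obj I}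
    (h : ∀ a, f.obj a = g.obj a) : f = g :=
  Hom.ext_mapOfEq h fun _ _ =>
    Subsingleton.elim (α := _ ⟶ subterminal V _) _ _

/-- Functions on the connected components of a graph are morphisms to discrete graphs. -/
noncomputable def componentsHomEquiv (X : EnrichedGraph.{w} V) (I : Type w) :
    (components X ⟶ I) ≃ (X ⟶ (discrete V).obj I) where
  toFun f :=
    { obj a := f (Quot.mk _ a)
      map a b := (nonempty_hom_subterminal fun h => congr_arg f (Quot.sound h)).some }
  invFun g := ↾Quot.lift g.obj fun a b h => of_hom_subterminal (g.map a b) h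
  left_inv f := by
    ext ⟨a⟩
    rfl
  right_inv g := discrete_hom_ext fun _ => rfl

instance : (discrete.{w} V).IsRightAdjoint :=
  ⟨_, ⟨Adjunction.adjunctionOfEquivLeft (G := discrete V) componentsHomEquiv
    fun _ _ _ _ _ => discrete_hom_ext fun _ => rfl⟩⟩

end Discrete

theorem isLocallyConnectedGrothendieckTopos (h : IsGrothendieckTopos V) :
    IsLocallyConnectedGrothendieckTopos (EnrichedGraph.{w} V) := by
  refine ⟨isGrothendieckTopos h, ?_⟩
  obtain ⟨D, _, J, ⟨e⟩⟩ := h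
  have : HasTerminal V := Adjunction.hasLimitsOfShape_of_equivalence e.functor
  have : HasFiniteCoproducts (Sheaf J (Type w)) := FinitaryPreExtensive.hasFiniteCoproducts
  have : HasInitial (Sheaf J (Type w)) := hasColimitsOfShape_discrete _ PEmpty
  have : HasInitial V := Adjunction.hasColimitsOfShape_of_equivalence e.functor
  have : HasStrictInitialObjects V := hasStrictInitialObjects_of_equivalence e
  exact ⟨terminalGraph V, isTerminalTerminalGraph, discrete V, discreteAdjunction V,
    inferInstance⟩

end EnrichedGraph

theorem mainTheorem10 {V : Type u} [Category.{w} V] (κ : Cardinal.{w}) [Fact κ.IsRegular] :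
    (IsCardinalLocallyPresentable V κ →
      IsCardinalLocallyPresentable (EnrichedGraph.{w} V) κ) ∧
    (IsCardinalLocallyPresentable V κ → HasStrictInitialObjects V →
      IsCardinalLocallyCPresentable (EnrichedGraph.{w} V) κ) ∧
    (IsCardinalLocallyPresentable V κ →
      IsCardinalLocallyCPresentable (EnrichedGraph.{w} (EnrichedGraph.{w} V)) κ) ∧
    (IsCardinalLocallyCPresentable V κ →
      IsCardinalLocallyCPresentable (EnrichedGraph.{w} V) κ) ∧
    (IsPresheafTopos V → IsPresheafTopos (EnrichedGraph.{w} V)) ∧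
    (IsGrothendieckTopos V → IsLocallyConnectedGrothendieckTopos (EnrichedGraph.{w} V)) :=
  open EnrichedGraph in
  ⟨isCardinalLocallyPresentable, isCardinalLocallyCPresentable,
    fun h => isCardinalLocallyCPresentable (isCardinalLocallyPresentable h)
      hasStrictInitialObjects,
    fun h => isCardinalLocallyCPresentable (isCardinalLocallyPresentable_of_cPresentable h)
      (hasStrictInitialObjects_of_cPresentable h),
    isPresheafTopos, isLocallyConnectedGrothendieckTopos⟩
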